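/- **Theorem (Focalization).** The focusing discipline is complete for (propositional) linear logic: for every formula $A$, if $\vdash A$ is provable in linear logic (with cut), then $\vdash A$ has a cut-free proof that respects the focusing discipline. Here formulas are built from atoms $X$ and negated atoms $X^\perp$ with $\otimes,\oplus,1,0,⅋,\&,\bot,\top,!,?$; sequents $\vdash\Gamma$ are one-sided, $\Gamma$ a finite multiset of formulas; the rules are the usual ones (axiom $\vdash A,A^\perp$ for every formula $A$; cut; the rules of $\otimes,\oplus,1,⅋,\&,\bot,\top$; promotion, dereliction, weakening, contraction). A formula is *positive* if it is an atom $X$ or its topmost connective is $\otimes,\oplus,1,0$ or $!$, and *negative* otherwise. A sequent is *stable* if none of its formulas has topmost connective $⅋,\&,\bot$ or $\top$. Two properties of cut-free proofs are defined simultaneously: "respects the focusing discipline", and "respects the focusing discipline with $A$ under focus" (for a proof of $\vdash\Gamma,A$ with a distinguished occurrence of $A$). 1. *No formula under focus.* A proof respects the discipline if and only if one of the following holds: - its last rule is that of $⅋$, $\&$, $\bot$ or $\top$, and the proofs of the premises (if any) respect the discipline; - its conclusion is stable, its last rule is weakening or contraction on a formula $?B$, and the proof of the premise respects the discipline; - its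 conclusion is stable, its last rule is dereliction on a formula $?B$, and the proof of the premise respects the discipline with $B$ under focus; - its conclusion $\vdash\Gamma,P$ is stable with $P$ positive, and the proof itself respects the discipline with $P$ under focus. 2. *Formula $A$ under focus.* A proof of $\vdash\Gamma,A$ respects the discipline with $A$ under focus if and only if one of the following holds: - $A$ is negative and the proof respects the discipline (focus is released); - $A=X$ is an atom and the proof is the axiom $\vdash X^\perp,X$; - $A=1$ and the proof is the rule $\vdash 1$; - $A=B\otimes C$, the last rule introduces $A$, and its premises are proved with $B$, respectively $C$, under focus; - $A=B\oplus C$, the last rule introduces $A$ from $B$ (or from $C$), and its premise is proved with $B$ (respectively $C$) under focus; - $A=\,!B$, the last rule is the promotion introducing $A$, and the proof of its premise respects the discipline. Thus connectives of the same polarity are decomposed in maximal groups, and negative formulas have priority. -/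

import Mathlib

namespace LinearLogic

universe u

/-- Formulas of (propositional) linear logic over a type `α` of atoms, in negation normal form:
`atom X` is the atom `X` and `natom X` is the negated atom `X⊥`. -/
inductive Formula (α : Type u) : Type u
  | atom (X : α)
  | natom (X : α)
  | tensor (A B : Formula α)
  | plus (A B : Formula α)
  | one
  | zero
  | par (A B : Formula α)
  | amp (A B : Formula α)
  | bot
  | top
  | bang (A : Formula α)
  | quest (A : Formula α)

namespace Formula

variable {α : Type u}

/-- Linear negation `A⊥`, defined by the De Morgan laws. -/
def dual : Formula α → Formula α
  | atom X => natom X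
  | natom X => atom X
  | tensor A B => par (dual A) (dual B)
  | plus A B => amp (dual A) (dual B)
  | one => bot
  | zero => top
  | par A B => tensor (dual A) (dual B)
  | amp A B => plus (dual A) (dual B)
  | bot => one
  | top => zero
  | bang A => quest (dual A)
  | quest A => bang (dual A)

/-- Positive formulas: atoms `X` and the formulas with topmost connective `⊗`, `⊕`, `1`, `0`, `!`. -/
def IsPositive : Formula α → Prop
  | atom _ | tensor _ _ | plus _ _ | one | zero | bang _ => True
  | natom _ | par _ _ | amp _ _ | bot | top | quest _ => False

/-- Negative formulas: negated atoms and the formulas with topmost connective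
`⅋`, `&`, `⊥`, `⊤`, `?`. -/
def IsNegative : Formula α → Prop
  | natom _ | par _ _ | amp _ _ | bot | top | quest _ => True
  | atom _ | tensor _ _ | plus _ _ | one | zero | bang _ => False

/-- The formulas whose topmost connective is `⅋`, `&`, `⊥` or `⊤`, i.e. the negative formulas that
are to be decomposed with priority. A negated atom cannot be decomposed. In the polarized reading
`?P` is `↑♭P` with `♭P` positive: its negative part is a mere shift, which leaves no trace in
a proof of linear logic, so that there is nothing to be decomposed with priority. -/
def IsReversible : Formula α → Prop
  | par _ _ | amp _ _ | bot | top => True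
  | _ => False

end Formula

open Formula

/-- Sequents `⊢ Γ` are finite multisets of formulas (exchange is implicit). -/
abbrev Sequent (α : Type u) : Type u := Multiset (Formula α)

/-- Proofs of the one-sided sequent calculus of linear logic, with cut: `Proof Γ` is the type of
proofs of `⊢ Γ`. -/
inductive Proof {α : Type u} : Sequent α → Type u
  | ax (A : Formula α) : Proof (A ::ₘ {A.dual})
  | cut {A : Formula α} {Γ Δ : Sequent α} :
      Proof (A ::ₘ Γ) → Proof (A.dual ::ₘ Δ) → Proof (Γ + Δ)
  | tensor {A B : Formula α} {Γ Δ : Sequent α} :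
      Proof (A ::ₘ Γ) → Proof (B ::ₘ Δ) → Proof (tensor A B ::ₘ (Γ + Δ))
  | plusLeft {A : Formula α} (B : Formula α) {Γ : Sequent α} :
      Proof (A ::ₘ Γ) → Proof (plus A B ::ₘ Γ)
  | plusRight (A : Formula α) {B : Formula α} {Γ : Sequent α} :
      Proof (B ::ₘ Γ) → Proof (plus A B ::ₘ Γ)
  | one : Proof {one}
  | par {A B : Formula α} {Γ : Sequent α} :
      Proof (A ::ₘ B ::ₘ Γ) → Proof (par A B ::ₘ Γ)
  | amp {A B : Formula α} {Γ : Sequent α} :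
      Proof (A ::ₘ Γ) → Proof (B ::ₘ Γ) → Proof (amp A B ::ₘ Γ)
  | bot {Γ : Sequent α} : Proof Γ → Proof (bot ::ₘ Γ)
  | top (Γ : Sequent α) : Proof (top ::ₘ Γ)
  | promotion {A : Formula α} {Γ : Sequent α} :
      Proof (A ::ₘ Γ.map quest) → Proof (bang A ::ₘ Γ.map quest)
  | dereliction {A : Formula α} {Γ : Sequent α} :
      Proof (A ::ₘ Γ) → Proof (quest A ::ₘ Γ)
  | weakening (A : Formula α) {Γ : Sequent α} :
      Proof Γ → Proof (quest A ::ₘ Γ)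
  | contraction {A : Formula α} {Γ : Sequent α} :
      Proof (quest A ::ₘ quest A ::ₘ Γ) → Proof (quest A ::ₘ Γ)

/-- The sequent `⊢ Γ` is provable in linear logic. -/
def Provable {α : Type u} (Γ : Sequent α) : Prop := Nonempty (Proof Γ)

/-- The proof has no instance of the cut rule. -/
def Proof.CutFree {α : Type u} : {Γ : Sequent α} → Proof Γ → Prop
  | _, .ax _ => True
  | _, .cut _ _ => False
  | _, .tensor p q => p.CutFree ∧ q.CutFree
  | _, .plusLeft _ p => p.CutFree
  | _, .plusRight _ p => p.CutFree
  | _, .one => True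
  | _, .par p => p.CutFree
  | _, .amp p q => p.CutFree ∧ q.CutFree
  | _, .bot p => p.CutFree
  | _, .top _ => True
  | _, .promotion p => p.CutFree
  | _, .dereliction p => p.CutFree
  | _, .weakening _ p => p.CutFree
  | _, .contraction p => p.CutFree

/-- No formula of `Γ` has to be decomposed with priority: every formula of `Γ` is positive,
a negated atom, or of the form `?A`. -/
def Sequent.NoReversible {α : Type u} (Γ : Sequent α) : Prop := ∀ B ∈ Γ, ¬ B.IsReversible

mutual

/-- `Focused p`: the proof `p` of `⊢ Γ` (read `⊢ Γ ;` with empty stoup) respects the focusing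
discipline. As long as the sequent has a formula with topmost connective `⅋`, `&`, `⊥`, `⊤`, only
the rules of these connectives may be used; otherwise, the structural rules on formulas `?A` may be
used, or a positive formula (or, by dereliction, the body of some `?A`) is put under focus. -/
inductive Focused {α : Type u} : {Γ : Sequent α} → Proof Γ → Prop
  | par {A B : Formula α} {Γ : Sequent α} {p : Proof (A ::ₘ B ::ₘ Γ)} :
      Focused p → Focused (Proof.par p)
  | amp {A B : Formula α} {Γ : Sequent α} {p : Proof (A ::ₘ Γ)} {q : Proof (B ::ₘ Γ)} :
      Focused p → Focused q → Focused (Proof.amp p q)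
  | bot {Γ : Sequent α} {p : Proof Γ} : Focused p → Focused (Proof.bot p)
  | top (Γ : Sequent α) : Focused (Proof.top Γ)
  | weakening (A : Formula α) {Γ : Sequent α} {p : Proof Γ} :
      Γ.NoReversible → Focused p → Focused (Proof.weakening A p)
  | contraction {A : Formula α} {Γ : Sequent α} {p : Proof (quest A ::ₘ quest A ::ₘ Γ)} :
      Γ.NoReversible → Focused p → Focused (Proof.contraction p)
  | dereliction {A : Formula α} {Γ : Sequent α} {p : Proof (A ::ₘ Γ)} :
      Γ.NoReversible → FocusedOn A p → Focused (Proof.dereliction p)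
  | focus {P : Formula α} {Γ : Sequent α} {p : Proof (P ::ₘ Γ)} :
      P.IsPositive → Γ.NoReversible → FocusedOn P p → Focused p

/-- `FocusedOn A p`: the proof `p` of `⊢ A, Γ` (read `⊢ Γ ; A` with `A` in the stoup) respects the
focusing discipline, where `A` is the formula under focus. As long as the formula under
focus is positive, it is the active formula and its immediate subformulas are under focus in the
premises (with `!A` read as `↓♯A`, so that focus is lost with the promotion rule); focus is released
when a negative formula is reached. -/
inductive FocusedOn {α : Type u} : (A : Formula α) → {Γ : Sequent α} → Proof (A ::ₘ Γ) → Prop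
  | ax (X : α) : FocusedOn (atom X) (Proof.ax (atom X))
  | one : FocusedOn Formula.one (Γ := 0) Proof.one
  | tensor {A B : Formula α} {Γ Δ : Sequent α} {p : Proof (A ::ₘ Γ)} {q : Proof (B ::ₘ Δ)} :
      FocusedOn A p → FocusedOn B q → FocusedOn (tensor A B) (Proof.tensor p q)
  | plusLeft {A : Formula α} (B : Formula α) {Γ : Sequent α} {p : Proof (A ::ₘ Γ)} :
      FocusedOn A p → FocusedOn (plus A B) (Proof.plusLeft B p)
  | plusRight (A : Formula α) {B : Formula α} {Γ : Sequent α} {p : Proof (B ::ₘ Γ)} :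
      FocusedOn B p → FocusedOn (plus A B) (Proof.plusRight A p)
  | promotion {A : Formula α} {Γ : Sequent α} {p : Proof (A ::ₘ Γ.map quest)} :
      Focused p → FocusedOn (bang A) (Proof.promotion p)
  | release {N : Formula α} {Γ : Sequent α} {p : Proof (N ::ₘ Γ)} :
      N.IsNegative → Focused p → FocusedOn N p

end

end LinearLogic

namespace LinearLogic

open Formula
open scoped Pointwise

variable {α : Type*}

-- The proof is semantic: cut is never eliminated by rewriting. Call two contexts orthogonal when
-- their sum has a cut-free focused proof. Each formula gets values and covalues, sets of stable
-- contexts. On the positive side, values are built exactly as the focused rules build proofs, with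
-- no biorthogonal closure, and covalues are their orthogonal; the negative side is dual.
--
-- Two results carry the argument. `soundness`: from any proof of a sequent, cuts included, every
-- sum of covalues of its formulas is cut-free focused provable; cut becomes
-- `focusedProvable_add_of_orthogonal`. `completeness`: a value of `A` gives a proof with `A` under
-- focus, and a context whose sum with every covalue of `A` is provable remains provable with `A` in
-- their place. For `⊢ A`, the second applies to the empty context, the first supplying its
-- hypothesis.

/-- `⊢ Γ` has a cut-free focused proof. -/
def FocusedProvable (Γ : Sequent α) : Prop := ∃ p : Proof Γ, p.CutFree ∧ Focused p

/-- `⊢ A, Γ` has a cut-free proof that is focused with `A` under focus. -/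
def FocusedProvableOn (A : Formula α) (Γ : Sequent α) : Prop :=
  ∃ p : Proof (A ::ₘ Γ), p.CutFree ∧ FocusedOn A p

-- Stable contexts and structural rules

namespace Sequent.NoReversible

theorem zero : NoReversible (0 : Sequent α) := by simp [NoReversible]

theorem add {Γ Δ : Sequent α} (hΓ : Γ.NoReversible) (hΔ : Δ.NoReversible) :
    NoReversible (Γ + Δ) := fun B hB ↦
  (Multiset.mem_add.1 hB).elim (hΓ B) (hΔ B)

theorem map_quest (Γ : Sequent α) : NoReversible (Γ.map quest) := fun B hB ↦ by
  obtain ⟨A, -, rfl⟩ := Multiset.mem_map.1 hB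
  exact id

theorem singleton {A : Formula α} (hA : ¬ A.IsReversible) : NoReversible ({A} : Sequent α) :=
  fun B hB ↦ by rwa [Multiset.mem_singleton.1 hB]

end Sequent.NoReversible

open Sequent

theorem FocusedProvableOn.focus {A : Formula α} {Γ : Sequent α} (hA : A.IsPositive)
    (hΓ : Γ.NoReversible) : FocusedProvableOn A Γ → FocusedProvable (A ::ₘ Γ)
  | ⟨p, hp, hf⟩ => ⟨p, hp, .focus hA hΓ hf⟩

theorem FocusedProvableOn.dereliction {A : Formula α} {Γ : Sequent α}
    (hΓ : Γ.NoReversible) : FocusedProvableOn A Γ → FocusedProvable (quest A ::ₘ Γ)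
  | ⟨p, hp, hf⟩ => ⟨.dereliction p, hp, .dereliction hΓ hf⟩

theorem FocusedProvableOn.release {A : Formula α} {Γ : Sequent α} (hA : A.IsNegative) :
    FocusedProvable (A ::ₘ Γ) → FocusedProvableOn A Γ
  | ⟨p, hp, hf⟩ => ⟨p, hp, .release hA hf⟩

/-- Weakening by a multiset of formulas `?A` in a stable context. -/
theorem FocusedProvable.weakening {Γ : Sequent α} (hΓ : Γ.NoReversible)
    (h : FocusedProvable Γ) (Θ : Sequent α) : FocusedProvable (Θ.map quest + Γ) := by
  induction Θ using Multiset.induction_on with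
  | empty => simpa using h
  | cons A Θ ih =>
    obtain ⟨p, hp, hf⟩ := ih
    rw [Multiset.map_cons, Multiset.cons_add]
    exact ⟨.weakening A p, hp, .weakening A ((NoReversible.map_quest Θ).add hΓ) hf⟩

/-- Contraction of a multiset of formulas `?A` in a stable context. -/
theorem FocusedProvable.contraction (Θ : Sequent α) {Γ : Sequent α} (hΓ : Γ.NoReversible)
    (h : FocusedProvable (Θ.map quest + (Θ.map quest + Γ))) :
    FocusedProvable (Θ.map quest + Γ) := by
  induction Θ using Multiset.induction_on generalizing Γ with
  | empty => simpa using h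
  | cons A Θ ih =>
    have hA : NoReversible ({quest A} : Sequent α) := .singleton id
    have h' : FocusedProvable (Θ.map quest + ({quest A} + ({quest A} + Γ))) := by
      -- Both copies of `?A` are moved into the side context, which stays stable, while the rest of
      -- `Θ` is contracted.
      refine ih (hA.add (hA.add hΓ)) ?_
      convert h using 1
      rw [Multiset.map_cons, ← Multiset.singleton_add]
      abel
    have e : Θ.map quest + ({quest A} + ({quest A} + Γ)) =
        quest A ::ₘ quest A ::ₘ (Θ.map quest + Γ) := by
      simp only [← Multiset.singleton_add]
      abel
    rw [e] at h'
    obtain ⟨p, hp, hf⟩ := h'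
    rw [Multiset.map_cons, Multiset.cons_add]
    exact ⟨.contraction p, hp, .contraction ((NoReversible.map_quest Θ).add hΓ) hf⟩

-- Orthogonality and the interpretation of formulas

/-- The stable contexts orthogonal to all elements of `S`, where `Γ` and `Δ` are orthogonal if
`⊢ Γ, Δ` has a cut-free focused proof. -/
def orthogonal (S : Set (Sequent α)) : Set (Sequent α) :=
  {Γ | Γ.NoReversible ∧ ∀ Δ ∈ S, FocusedProvable (Γ + Δ)}

/-- The contexts of the form `?Θ` orthogonal to all elements of `S`. -/
def questOrthogonal (S : Set (Sequent α)) : Set (Sequent α) :=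
  {Γ | (∃ Θ : Sequent α, Γ = Θ.map quest) ∧ ∀ Δ ∈ S, FocusedProvable (Γ + Δ)}

/-- The interpretations of `A` and of `A⊥` as sets of stable contexts. The interpretation of a
positive formula follows its focused introduction rules; that of a negative formula is the
orthogonal of the interpretation of its dual. -/
def interp : Formula α → Set (Sequent α) × Set (Sequent α)
  | .atom X => ({{natom X}}, orthogonal {{natom X}})
  | .natom X => (orthogonal {{natom X}}, {{natom X}})
  | .tensor A B => ((interp A).1 + (interp B).1, orthogonal ((interp A).1 + (interp B).1))
  | .par A B => (orthogonal ((interp A).2 + (interp B).2), (interp A).2 + (interp B).2)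
  | .plus A B => ((interp A).1 ∪ (interp B).1, orthogonal ((interp A).1 ∪ (interp B).1))
  | .amp A B => (orthogonal ((interp A).2 ∪ (interp B).2), (interp A).2 ∪ (interp B).2)
  | .one => ({0}, orthogonal {0})
  | .bot => (orthogonal {0}, {0})
  | .zero => (∅, orthogonal ∅)
  | .top => (orthogonal ∅, ∅)
  | .bang A => (questOrthogonal (interp A).2, orthogonal (questOrthogonal (interp A).2))
  | .quest A => (orthogonal (questOrthogonal (interp A).1), questOrthogonal (interp A).1)

/-- The values of a formula: contexts `Γ` such that `⊢ Γ, A` is provable with `A` under focus. -/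
def values (A : Formula α) : Set (Sequent α) := (interp A).1

/-- The values of the dual of a formula. -/
def covalues (A : Formula α) : Set (Sequent α) := (interp A).2

/-- Defining both components by one recursion is what makes negation a mere exchange. -/
theorem interp_dual (A : Formula α) : interp A.dual = (interp A).swap := by
  induction A <;> simp_all [interp, dual]

theorem covalues_dual (A : Formula α) : covalues A.dual = values A := by
  simp [values, covalues, interp_dual]

theorem covalues_eq_of_isPositive {A : Formula α} (hA : A.IsPositive) :
    covalues A = orthogonal (values A) := by
  cases A <;> first | rfl | exact hA.elim

theorem values_eq_of_isNegative {A : Formula α} (hA : A.IsNegative) :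
    values A = orthogonal (covalues A) := by
  cases A <;> first | rfl | exact hA.elim

theorem isPositive_or_isNegative (A : Formula α) : A.IsPositive ∨ A.IsNegative := by
  cases A <;> simp [IsPositive, IsNegative]

/-- Stability is the side condition of focus, dereliction, weakening and contraction, so it must be
built into every interpretation. -/
theorem noReversible_of_mem_interp (A : Formula α) :
    (∀ Γ ∈ (interp A).1, Γ.NoReversible) ∧ ∀ Γ ∈ (interp A).2, Γ.NoReversible := by
  have hq : ∀ S : Set (Sequent α), ∀ Γ ∈ questOrthogonal S, Γ.NoReversible := by
    rintro S _ ⟨⟨Θ, rfl⟩, -⟩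
    exact .map_quest Θ
  have ha : ∀ {S T : Set (Sequent α)}, (∀ Γ ∈ S, Γ.NoReversible) → (∀ Γ ∈ T, Γ.NoReversible) →
      ∀ Γ ∈ S + T, Γ.NoReversible := by
    rintro S T hS hT _ ⟨Γ, hΓ, Δ, hΔ, rfl⟩
    exact (hS Γ hΓ).add (hT Δ hΔ)
  have ho : ∀ S : Set (Sequent α), ∀ Γ ∈ orthogonal S, Γ.NoReversible := fun _ _ h ↦ h.1
  have hn : ∀ X : α, ∀ Γ ∈ ({{natom X}} : Set (Sequent α)), Γ.NoReversible := by
    rintro X _ rfl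
    exact .singleton id
  have hz : ∀ Γ ∈ ({0} : Set (Sequent α)), Γ.NoReversible := by
    rintro _ rfl
    exact .zero
  induction A with
  | atom X => exact ⟨hn X, ho _⟩
  | natom X => exact ⟨ho _, hn X⟩
  | tensor A B ihA ihB => exact ⟨ha ihA.1 ihB.1, ho _⟩
  | par A B ihA ihB => exact ⟨ho _, ha ihA.2 ihB.2⟩
  | plus A B ihA ihB => exact ⟨fun Γ h ↦ h.elim (ihA.1 Γ) (ihB.1 Γ), ho _⟩
  | amp A B ihA ihB => exact ⟨ho _, fun Γ h ↦ h.elim (ihA.2 Γ) (ihB.2 Γ)⟩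
  | one => exact ⟨hz, ho _⟩
  | bot => exact ⟨ho _, hz⟩
  | zero => exact ⟨fun _ h ↦ h.elim, ho _⟩
  | top => exact ⟨ho _, fun _ h ↦ h.elim⟩
  | bang A => exact ⟨hq _, ho _⟩
  | quest A => exact ⟨ho _, hq _⟩

theorem noReversible_of_mem_values {A : Formula α} {Γ : Sequent α} (h : Γ ∈ values A) :
    Γ.NoReversible := (noReversible_of_mem_interp A).1 Γ h

theorem noReversible_of_mem_covalues {A : Formula α} {Γ : Sequent α} (h : Γ ∈ covalues A) :
    Γ.NoReversible := (noReversible_of_mem_interp A).2 Γ h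

/-- Values and covalues are orthogonal. -/
theorem focusedProvable_add_of_mem {A : Formula α} {Γ Δ : Sequent α} (hΓ : Γ ∈ values A)
    (hΔ : Δ ∈ covalues A) : FocusedProvable (Δ + Γ) := by
  obtain hA | hA := isPositive_or_isNegative A
  · rw [covalues_eq_of_isPositive hA] at hΔ
    exact hΔ.2 Γ hΓ
  · rw [values_eq_of_isNegative hA] at hΓ
    rw [add_comm]
    exact hΓ.2 Δ hΔ

/-- Semantic cut: stable contexts orthogonal to the covalues, respectively the values, of a formula
are orthogonal. -/
theorem focusedProvable_add_of_orthogonal {A : Formula α} {Γ Δ : Sequent α}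
    (hΓ : Γ ∈ orthogonal (covalues A)) (hΔ : Δ ∈ orthogonal (values A)) :
    FocusedProvable (Δ + Γ) := by
  obtain hA | hA := isPositive_or_isNegative A
  · rw [← covalues_eq_of_isPositive hA] at hΔ
    rw [add_comm]
    exact hΓ.2 Δ hΔ
  · rw [← values_eq_of_isNegative hA] at hΓ
    exact hΔ.2 Γ hΓ

-- From values to focused proofs

/-- Values give proofs with the formula under focus, and a context orthogonal to all covalues of
a formula `A` (stable or not) can be completed by `A`. -/
theorem completeness (A : Formula α) :
    (∀ Γ ∈ values A, FocusedProvableOn A Γ) ∧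
      ∀ Γ : Sequent α, (∀ Δ ∈ covalues A, FocusedProvable (Δ + Γ)) →
        FocusedProvable (A ::ₘ Γ) := by
  have pos : ∀ A : Formula α, A.IsPositive → (∀ Γ ∈ values A, FocusedProvableOn A Γ) →
      (∀ Γ ∈ values A, FocusedProvableOn A Γ) ∧
      ∀ Γ : Sequent α, (∀ Δ ∈ covalues A, FocusedProvable (Δ + Γ)) →
        FocusedProvable (A ::ₘ Γ) := by
    intro A hA h
    refine ⟨h, fun Γ hΓ ↦ ?_⟩
    rw [← Multiset.singleton_add]
    -- The context `{A}` is itself a covalue of a positive `A`: against any value, `A` can be put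
    -- under focus.
    refine hΓ _ ?_
    rw [covalues_eq_of_isPositive hA]
    refine ⟨.singleton (by cases A <;> first | exact id | exact hA.elim), fun Δ hΔ ↦ ?_⟩
    exact (h Δ hΔ).focus hA (noReversible_of_mem_values hΔ)
  have neg : ∀ A : Formula α, A.IsNegative →
      (∀ Γ : Sequent α, (∀ Δ ∈ covalues A, FocusedProvable (Δ + Γ)) →
        FocusedProvable (A ::ₘ Γ)) →
      (∀ Γ ∈ values A, FocusedProvableOn A Γ) ∧
      ∀ Γ : Sequent α, (∀ Δ ∈ covalues A, FocusedProvable (Δ + Γ)) →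
        FocusedProvable (A ::ₘ Γ) := by
    intro A hA h
    refine ⟨fun Γ hΓ ↦ .release hA (h Γ fun Δ hΔ ↦ ?_), h⟩
    exact focusedProvable_add_of_mem hΓ hΔ
  induction A with
  | atom X =>
    refine pos _ trivial ?_
    rintro _ rfl
    exact ⟨.ax (.atom X), trivial, .ax X⟩
  | natom X => exact neg _ trivial fun Γ hΓ ↦ hΓ _ rfl
  | tensor A B ihA ihB =>
    refine pos _ trivial ?_
    rintro _ ⟨Γ, hΓ, Δ, hΔ, rfl⟩
    obtain ⟨p, hp, hp'⟩ := ihA.1 Γ hΓ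
    obtain ⟨q, hq, hq'⟩ := ihB.1 Δ hΔ
    exact ⟨.tensor p q, ⟨hp, hq⟩, .tensor hp' hq'⟩
  | plus A B ihA ihB =>
    refine pos _ trivial ?_
    rintro Γ (hΓ | hΓ)
    · obtain ⟨p, hp, hp'⟩ := ihA.1 Γ hΓ
      exact ⟨.plusLeft B p, hp, .plusLeft B hp'⟩
    · obtain ⟨p, hp, hp'⟩ := ihB.1 Γ hΓ
      exact ⟨.plusRight A p, hp, .plusRight A hp'⟩
  | one =>
    refine pos _ trivial ?_
    rintro _ rfl
    exact ⟨.one, trivial, .one⟩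
  | zero => exact pos _ trivial fun _ h ↦ h.elim
  | bang A ih =>
    refine pos _ trivial ?_
    rintro _ ⟨⟨Θ, rfl⟩, h⟩
    obtain ⟨p, hp, hp'⟩ := ih.2 (Θ.map quest) fun Δ hΔ ↦ add_comm (Θ.map quest) Δ ▸ h Δ hΔ
    exact ⟨.promotion p, hp, .promotion hp'⟩
  | par A B ihA ihB =>
    refine neg _ trivial fun Γ hΓ ↦ ?_
    have h : FocusedProvable (A ::ₘ B ::ₘ Γ) := by
      -- Here the remaining context contains `B`, which may be reversible; hence the induction
      -- hypothesis for arbitrary contexts.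
      refine ihA.2 _ fun Δ hΔ ↦ ?_
      rw [Multiset.add_cons]
      refine ihB.2 _ fun Δ' hΔ' ↦ ?_
      rw [← add_assoc, add_comm Δ']
      exact hΓ _ (Set.add_mem_add hΔ hΔ')
    obtain ⟨p, hp, hp'⟩ := h
    exact ⟨.par p, hp, .par hp'⟩
  | amp A B ihA ihB =>
    refine neg _ trivial fun Γ hΓ ↦ ?_
    obtain ⟨p, hp, hp'⟩ := ihA.2 Γ fun Δ hΔ ↦ hΓ Δ (.inl hΔ)
    obtain ⟨q, hq, hq'⟩ := ihB.2 Γ fun Δ hΔ ↦ hΓ Δ (.inr hΔ)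
    exact ⟨.amp p q, ⟨hp, hq⟩, .amp hp' hq'⟩
  | bot =>
    refine neg _ trivial fun Γ hΓ ↦ ?_
    obtain ⟨p, hp, hp'⟩ := zero_add Γ ▸ hΓ 0 rfl
    exact ⟨.bot p, hp, .bot hp'⟩
  | top => exact neg _ trivial fun Γ _ ↦ ⟨.top Γ, trivial, .top Γ⟩
  | quest A ih =>
    refine neg _ trivial fun Γ hΓ ↦ ?_
    rw [← Multiset.singleton_add]
    -- The context `{?A}` is a covalue of `?A`, since dereliction puts `A` under focus against any
    -- of its values.
    refine hΓ _ ⟨⟨{A}, rfl⟩, fun Δ hΔ ↦ ?_⟩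
    exact (ih.1 Δ hΔ).dereliction (noReversible_of_mem_values hΔ)

-- Soundness of proofs with cut

/-- The sums of covalues of the formulas of a sequent. -/
def sequentCovalues (Γ : Sequent α) : Set (Sequent α) := (Γ.map covalues).sum

theorem sequentCovalues_cons (A : Formula α) (Γ : Sequent α) :
    sequentCovalues (A ::ₘ Γ) = covalues A + sequentCovalues Γ := by
  simp [sequentCovalues]

theorem sequentCovalues_add (Γ Δ : Sequent α) :
    sequentCovalues (Γ + Δ) = sequentCovalues Γ + sequentCovalues Δ := by
  simp [sequentCovalues]

theorem sequentCovalues_singleton (A : Formula α) : sequentCovalues {A} = covalues A := by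
  simp [sequentCovalues]

theorem noReversible_of_mem_sequentCovalues {Γ Δ : Sequent α} (h : Δ ∈ sequentCovalues Γ) :
    Δ.NoReversible := by
  induction Γ using Multiset.induction_on generalizing Δ with
  | empty =>
    obtain rfl : Δ = 0 := by simpa [sequentCovalues] using h
    exact .zero
  | cons A Γ ih =>
    rw [sequentCovalues_cons] at h
    obtain ⟨a, ha, b, hb, rfl⟩ := h
    exact (noReversible_of_mem_covalues ha).add (ih hb)

/-- This is the semantic counterpart of the context restriction of promotion. -/
theorem exists_eq_map_quest_of_mem_sequentCovalues {Γ Δ : Sequent α}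
    (h : Δ ∈ sequentCovalues (Γ.map quest)) : ∃ Θ : Sequent α, Δ = Θ.map quest := by
  induction Γ using Multiset.induction_on generalizing Δ with
  | empty => exact ⟨0, by simpa [sequentCovalues] using h⟩
  | cons A Γ ih =>
    rw [Multiset.map_cons, sequentCovalues_cons] at h
    obtain ⟨_, ⟨⟨Θ, rfl⟩, -⟩, b, hb, rfl⟩ := h
    obtain ⟨Θ', rfl⟩ := ih hb
    exact ⟨Θ + Θ', (Multiset.map_add _ _ _).symm⟩

/-- If the covalues of the conclusion `⊢ A, Γ` of a proof are cut-free focused provable, then the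
covalues of `Γ` are orthogonal to those of `A`. -/
theorem mem_orthogonal_covalues {A : Formula α} {Γ Δ : Sequent α}
    (h : ∀ Θ ∈ sequentCovalues (A ::ₘ Γ), FocusedProvable Θ) (hΔ : Δ ∈ sequentCovalues Γ) :
    Δ ∈ orthogonal (covalues A) := by
  refine ⟨noReversible_of_mem_sequentCovalues hΔ, fun a ha ↦ h _ ?_⟩
  rw [sequentCovalues_cons, add_comm]
  exact Set.add_mem_add hΔ ha

/-- Every proof of linear logic, with cut, is sound for the interpretation. -/
theorem soundness {Γ : Sequent α} (p : Proof Γ) :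
    ∀ Δ ∈ sequentCovalues Γ, FocusedProvable Δ := by
  induction p with
  | ax A =>
    rw [sequentCovalues_cons, sequentCovalues_singleton, covalues_dual]
    rintro _ ⟨a, ha, b, hb, rfl⟩
    exact focusedProvable_add_of_mem hb ha
  | @cut A Γ Δ _ _ ihp ihq =>
    rw [sequentCovalues_add]
    rintro _ ⟨γ, hγ, δ, hδ, rfl⟩
    change FocusedProvable (γ + δ)
    rw [add_comm]
    refine focusedProvable_add_of_orthogonal (mem_orthogonal_covalues ihp hγ) ?_
    rw [← covalues_dual]
    exact mem_orthogonal_covalues ihq hδ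
  | @tensor A B Γ Δ _ _ ihp ihq =>
    rw [sequentCovalues_cons, sequentCovalues_add]
    rintro _ ⟨c, hc, _, ⟨γ, hγ, δ, hδ, rfl⟩, rfl⟩
    change FocusedProvable (c + (γ + δ))
    rw [← add_assoc]
    -- Two semantic cuts, on `B` and then on `A`, replace `δ` and `γ` by values `b` and `a`, whose
    -- sum is a value of the tensor.
    refine focusedProvable_add_of_orthogonal (A := B) (mem_orthogonal_covalues ihq hδ)
      ⟨hc.1.add (noReversible_of_mem_sequentCovalues hγ), fun b hb ↦ ?_⟩
    rw [add_right_comm]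
    refine focusedProvable_add_of_orthogonal (A := A) (mem_orthogonal_covalues ihp hγ)
      ⟨hc.1.add (noReversible_of_mem_values hb), fun a ha ↦ ?_⟩
    rw [add_assoc, add_comm b]
    exact hc.2 _ (Set.add_mem_add ha hb)
  | @plusLeft A B Γ _ ih =>
    rw [sequentCovalues_cons]
    rintro _ ⟨c, hc, γ, hγ, rfl⟩
    exact focusedProvable_add_of_orthogonal (mem_orthogonal_covalues ih hγ)
      ⟨hc.1, fun a ha ↦ hc.2 a (.inl ha)⟩
  | @plusRight A B Γ _ ih =>
    rw [sequentCovalues_cons]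
    rintro _ ⟨c, hc, γ, hγ, rfl⟩
    exact focusedProvable_add_of_orthogonal (mem_orthogonal_covalues ih hγ)
      ⟨hc.1, fun a ha ↦ hc.2 a (.inr ha)⟩
  | one =>
    rw [sequentCovalues_singleton]
    intro c hc
    exact add_zero c ▸ hc.2 0 rfl
  | @par A B Γ _ ih =>
    rw [sequentCovalues_cons]
    rw [sequentCovalues_cons, sequentCovalues_cons, ← add_assoc] at ih
    exact ih
  | @amp A B Γ _ _ ihp ihq =>
    rw [sequentCovalues_cons]
    rw [sequentCovalues_cons] at ihp ihq
    rintro _ ⟨c, hc | hc, γ, hγ, rfl⟩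
    · exact ihp _ (Set.add_mem_add hc hγ)
    · exact ihq _ (Set.add_mem_add hc hγ)
  | @bot Γ _ ih =>
    rw [sequentCovalues_cons]
    rintro _ ⟨_, rfl, γ, hγ, rfl⟩
    change FocusedProvable (0 + γ)
    rw [zero_add]
    exact ih γ hγ
  | top Γ =>
    rw [sequentCovalues_cons]
    rintro _ ⟨_, (h : _ ∈ (∅ : Set _)), -⟩
    exact h.elim
  | @promotion A Γ _ ih =>
    rw [sequentCovalues_cons]
    rintro _ ⟨c, hc, γ, hγ, rfl⟩
    -- The context `γ` has the form `?Θ` and is orthogonal to the covalues of `A`, so it is a value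
    -- of `!A`.
    exact hc.2 γ ⟨exists_eq_map_quest_of_mem_sequentCovalues hγ,
      (mem_orthogonal_covalues ih hγ).2⟩
  | @dereliction A Γ _ ih =>
    rw [sequentCovalues_cons]
    rintro _ ⟨c, hc, γ, hγ, rfl⟩
    exact focusedProvable_add_of_orthogonal (mem_orthogonal_covalues ih hγ)
      ⟨noReversible_of_mem_covalues (A := quest A) hc, hc.2⟩
  | @weakening A Γ _ ih =>
    rw [sequentCovalues_cons]
    rintro _ ⟨_, ⟨⟨Θ, rfl⟩, -⟩, γ, hγ, rfl⟩
    -- Covalues of `?A` consist of `?`-formulas only, so they can be weakened, and likewise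
    -- contracted.
    exact (ih γ hγ).weakening (noReversible_of_mem_sequentCovalues hγ) Θ
  | @contraction A Γ _ ih =>
    rw [sequentCovalues_cons]
    rw [sequentCovalues_cons, sequentCovalues_cons] at ih
    rintro _ ⟨c, hc, γ, hγ, rfl⟩
    obtain ⟨Θ, rfl⟩ := hc.1
    exact .contraction Θ (noReversible_of_mem_sequentCovalues hγ)
      (ih _ (Set.add_mem_add hc (Set.add_mem_add hc hγ)))

end LinearLogic

theorem mainTheorem4 {α : Type*} (A : LinearLogic.Formula α)
    (hA : LinearLogic.Provable ({A} : LinearLogic.Sequent α)) :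
    ∃ p : LinearLogic.Proof ({A} : LinearLogic.Sequent α),
      p.CutFree ∧ LinearLogic.Focused p := by
  obtain ⟨p⟩ := hA
  refine (LinearLogic.completeness A).2 0 fun Δ hΔ ↦ ?_
  rw [add_zero]
  exact LinearLogic.soundness p Δ (LinearLogic.sequentCovalues_singleton A ▸ hΔ)
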